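/- A \emph{left adequate monoid} is a monoid $M$ with a unary operation $x\mapsto x^+$ satisfying $x^+x = x$, $(x^+y^+)^+ = x^+y^+ = y^+x^+$, $(xy)^+ = (xy^+)^+$, $x^2=x\Rightarrow x=x^+$, and $xz=yz\Rightarrow xz^+=yz^+$. A \emph{right adequate monoid} is a monoid with a unary operation $x\mapsto x^*$ satisfying the left-right dual conditions $xx^*=x$, $(x^*y^*)^*=x^*y^*=y^*x^*$, $(xy)^*=(x^*y)^*$, $x^2=x\Rightarrow x=x^*$, and $zx=zy\Rightarrow z^*x=z^*y$. Let $\mathrm{FLAd}(a)$ and $\mathrm{FRAd}(a)$ be the free left adequate and the free right adequate monoid on one generator $a$ (free in the signature that includes the unary operation). For a set $\Sigma$ let $\mathrm{F}(\Sigma)$ be the free monoid on $\Sigma$. For $w\in \mathrm{F}(\Sigma)$ and $x\in\Sigma$ let $|w|_x$ be the number of occurrences of $x$ in $w$, let $\mathrm{suff}_w(x)$ be the shortest suffix of $w$ containing $x$, and $\mathrm{pref}_w(x)$ the shortest prefix of $w$ containing $x$; if $x$ does not occur in $w$, both are defined to be $w$. A monoid $M$ satisfies the monoid identity $u\approx v$,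 where $u,v\in \mathrm{F}(\Sigma)$, if $\phi(u)=\phi(v)$ for all monoid morphisms $\phi\colon \mathrm{F}(\Sigma)\to M$. The identity $u\approx v$ is a consequence of $p\approx q$ if every monoid satisfying $p\approx q$ satisfies $u\approx v$. The monoid variety generated by $M$ is the smallest class of monoids that contains $M$ and is closed under homomorphic images, submonoids and direct products. The sylvester monoid is the monoid generated by the positive integers subject to the relations $cavb=acvb$ for all $a\le b<c$ and all words $v$; the $\#$-sylvester monoid is the monoid generated by the positive integers subject to the relations $bvac=bvca$ for all $a<b\le c$ and all words $v$. Let $\Sigma$ be a set and $u,v\in \mathrm{F}(\Sigma)$. Then: (1) The following are equivalent: (i) $\mathrm{FLAd}(a)$ satisfies the monoid identity $u\approx v$; (ii) $|u|_y=|v|_y$ and $|\mathrm{suff}_u(x)|_y=|\mathrm{suff}_v(x)|_y$ for all $x,y\in\Sigma$; (iii) $u\approx v$ is a consequence of the identity $xyzxty\approx yxzxty$. (2) The following are equivalent: (i) $\mathrm{FRAd}(a)$ satisfies the monoid identity $u\approx v$; (ii) $|u|_y=|v|_y$ and $|\mathrm{pref}_u(x)|_y=|\mathrm{pref}_v(x)|_y$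 for all $x,y\in\Sigma$; (iii) $u\approx v$ is a consequence of the identity $xzytxy\approx xzytyx$. (3) $\mathrm{FLAd}(a)$ and the sylvester monoid generate the same monoid variety, and $\mathrm{FRAd}(a)$ and the $\#$-sylvester monoid generate the same monoid variety. -/

import Mathlib

universe u v w

/-! ### Left and right adequate monoids -/

/-- A left adequate monoid: a monoid with a unary operation `plus` (written `x ↦ x⁺` below)
satisfying the quasi-identities listed as fields. -/
class LeftAdequateMonoid (M : Type u) extends Monoid M where
  /-- the unary operation -/
  plus : M → M
  /-- `x⁺ x = x` -/
  plus_mul_self : ∀ x : M, plus x * x = x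
  /-- `(x⁺ y⁺)⁺ = x⁺ y⁺` -/
  plus_plus_mul_plus : ∀ x y : M, plus (plus x * plus y) = plus x * plus y
  /-- `x⁺ y⁺ = y⁺ x⁺` -/
  plus_comm : ∀ x y : M, plus x * plus y = plus y * plus x
  /-- `(x y)⁺ = (x y⁺)⁺` -/
  plus_mul : ∀ x y : M, plus (x * y) = plus (x * plus y)
  /-- `x² = x` implies `x = x⁺` -/
  eq_plus_of_idem : ∀ x : M, x * x = x → x = plus x
  /-- `x z = y z` implies `x z⁺ = y z⁺` -/
  mul_plus_cancel : ∀ x y z : M, x * z = y * z → x * plus z = y * plus z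

/-- A right adequate monoid: a monoid with a unary operation `star` (written `x ↦ x*` below)
satisfying the quasi-identities listed as fields. -/
class RightAdequateMonoid (M : Type u) extends Monoid M where
  /-- the unary operation -/
  star : M → M
  /-- `x x* = x` -/
  mul_star_self : ∀ x : M, x * star x = x
  /-- `(x* y*)* = x* y*` -/
  star_star_mul_star : ∀ x y : M, star (star x * star y) = star x * star y
  /-- `x* y* = y* x*` -/
  star_comm : ∀ x y : M, star x * star y = star y * star x
  /-- `(x y)* = (x* y)*` -/
  star_mul : ∀ x y : M, star (x * y) = star (star x * y)
  /-- `x² = x` implies `x = x*` -/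
  eq_star_of_idem : ∀ x : M, x * x = x → x = star x
  /-- `z x = z y` implies `z* x = z* y` -/
  star_mul_cancel : ∀ x y z : M, z * x = z * y → star z * x = star z * y

/-! ### The free left and right adequate monoids -/

/-- Terms over `X` in the signature with one binary, one unary and one nullary symbol. -/
inductive UTerm (X : Type u) : Type u
  | of : X → UTerm X
  | one : UTerm X
  | mul : UTerm X → UTerm X → UTerm X
  | un : UTerm X → UTerm X

/-- The least relation on terms that is a congruence and is closed under the monoid laws and the
quasi-identities of left adequate monoids (with `un` in the role of `⁺`). -/
inductive LeftAdequateRel (X : Type u) : UTerm X → UTerm X → Prop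
  | refl (s) : LeftAdequateRel X s s
  | symm {s t} : LeftAdequateRel X s t → LeftAdequateRel X t s
  | trans {s t r} : LeftAdequateRel X s t → LeftAdequateRel X t r → LeftAdequateRel X s r
  | mul_congr {s s' t t'} : LeftAdequateRel X s s' → LeftAdequateRel X t t' →
      LeftAdequateRel X (.mul s t) (.mul s' t')
  | un_congr {s s'} : LeftAdequateRel X s s' → LeftAdequateRel X (.un s) (.un s')
  | mul_assoc (x y z) : LeftAdequateRel X (.mul (.mul x y) z) (.mul x (.mul y z))
  | one_mul (x) : LeftAdequateRel X (.mul .one x) x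
  | mul_one (x) : LeftAdequateRel X (.mul x .one) x
  | plus_mul_self (x) : LeftAdequateRel X (.mul (.un x) x) x
  | plus_plus_mul_plus (x y) :
      LeftAdequateRel X (.un (.mul (.un x) (.un y))) (.mul (.un x) (.un y))
  | plus_comm (x y) : LeftAdequateRel X (.mul (.un x) (.un y)) (.mul (.un y) (.un x))
  | plus_mul (x y) : LeftAdequateRel X (.un (.mul x y)) (.un (.mul x (.un y)))
  | eq_plus_of_idem (x) : LeftAdequateRel X (.mul x x) x → LeftAdequateRel X x (.un x)
  | mul_plus_cancel (x y z) : LeftAdequateRel X (.mul x z) (.mul y z) →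
      LeftAdequateRel X (.mul x (.un z)) (.mul y (.un z))

/-- The least relation on terms that is a congruence and is closed under the monoid laws and the
quasi-identities of right adequate monoids (with `un` in the role of `*`). -/
inductive RightAdequateRel (X : Type u) : UTerm X → UTerm X → Prop
  | refl (s) : RightAdequateRel X s s
  | symm {s t} : RightAdequateRel X s t → RightAdequateRel X t s
  | trans {s t r} : RightAdequateRel X s t → RightAdequateRel X t r → RightAdequateRel X s r
  | mul_congr {s s' t t'} : RightAdequateRel X s s' → RightAdequateRel X t t' →
      RightAdequateRel X (.mul s t) (.mul s' t')
  | un_congr {s s'} : RightAdequateRel X s s' → RightAdequateRel X (.un s) (.un s')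
  | mul_assoc (x y z) : RightAdequateRel X (.mul (.mul x y) z) (.mul x (.mul y z))
  | one_mul (x) : RightAdequateRel X (.mul .one x) x
  | mul_one (x) : RightAdequateRel X (.mul x .one) x
  | mul_star_self (x) : RightAdequateRel X (.mul x (.un x)) x
  | star_star_mul_star (x y) :
      RightAdequateRel X (.un (.mul (.un x) (.un y))) (.mul (.un x) (.un y))
  | star_comm (x y) : RightAdequateRel X (.mul (.un x) (.un y)) (.mul (.un y) (.un x))
  | star_mul (x y) : RightAdequateRel X (.un (.mul x y)) (.un (.mul (.un x) y))
  | eq_star_of_idem (x) : RightAdequateRel X (.mul x x) x → RightAdequateRel X x (.un x)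
  | star_mul_cancel (x y z) : RightAdequateRel X (.mul z x) (.mul z y) →
      RightAdequateRel X (.mul (.un z) x) (.mul (.un z) y)

/-- `LeftAdequateRel` as a setoid. -/
def leftAdequateSetoid (X : Type u) : Setoid (UTerm X) :=
  ⟨LeftAdequateRel X, .refl, .symm, .trans⟩

/-- `RightAdequateRel` as a setoid. -/
def rightAdequateSetoid (X : Type u) : Setoid (UTerm X) :=
  ⟨RightAdequateRel X, .refl, .symm, .trans⟩

/-- The free left adequate monoid `FLAd(X)`. -/
def FLAd (X : Type u) : Type u := Quotient (leftAdequateSetoid X)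

/-- The free right adequate monoid `FRAd(X)`. -/
def FRAd (X : Type u) : Type u := Quotient (rightAdequateSetoid X)

/-- The free generators of `FLAd(X)`. -/
def FLAd.of {X : Type u} (x : X) : FLAd X := Quotient.mk (leftAdequateSetoid X) (.of x)

/-- The free generators of `FRAd(X)`. -/
def FRAd.of {X : Type u} (x : X) : FRAd X := Quotient.mk (rightAdequateSetoid X) (.of x)

instance FLAd.instLeftAdequateMonoid (X : Type u) : LeftAdequateMonoid (FLAd X) where
  mul := Quotient.map₂ UTerm.mul fun _ _ h _ _ k => .mul_congr h k
  one := Quotient.mk (leftAdequateSetoid X) .one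
  plus := Quotient.map UTerm.un fun _ _ h => .un_congr h
  mul_assoc := by
    rintro ⟨x⟩ ⟨y⟩ ⟨z⟩; exact Quotient.sound (LeftAdequateRel.mul_assoc x y z)
  one_mul := by rintro ⟨x⟩; exact Quotient.sound (LeftAdequateRel.one_mul x)
  mul_one := by rintro ⟨x⟩; exact Quotient.sound (LeftAdequateRel.mul_one x)
  plus_mul_self := by rintro ⟨x⟩; exact Quotient.sound (LeftAdequateRel.plus_mul_self x)
  plus_plus_mul_plus := by
    rintro ⟨x⟩ ⟨y⟩; exact Quotient.sound (LeftAdequateRel.plus_plus_mul_plus x y)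
  plus_comm := by rintro ⟨x⟩ ⟨y⟩; exact Quotient.sound (LeftAdequateRel.plus_comm x y)
  plus_mul := by rintro ⟨x⟩ ⟨y⟩; exact Quotient.sound (LeftAdequateRel.plus_mul x y)
  eq_plus_of_idem := by
    rintro ⟨x⟩ h
    exact Quotient.sound (LeftAdequateRel.eq_plus_of_idem x (Quotient.exact h))
  mul_plus_cancel := by
    rintro ⟨x⟩ ⟨y⟩ ⟨z⟩ h
    exact Quotient.sound (LeftAdequateRel.mul_plus_cancel x y z (Quotient.exact h))

instance FRAd.instRightAdequateMonoid (X : Type u) : RightAdequateMonoid (FRAd X) where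
  mul := Quotient.map₂ UTerm.mul fun _ _ h _ _ k => .mul_congr h k
  one := Quotient.mk (rightAdequateSetoid X) .one
  star := Quotient.map UTerm.un fun _ _ h => .un_congr h
  mul_assoc := by
    rintro ⟨x⟩ ⟨y⟩ ⟨z⟩; exact Quotient.sound (RightAdequateRel.mul_assoc x y z)
  one_mul := by rintro ⟨x⟩; exact Quotient.sound (RightAdequateRel.one_mul x)
  mul_one := by rintro ⟨x⟩; exact Quotient.sound (RightAdequateRel.mul_one x)
  mul_star_self := by rintro ⟨x⟩; exact Quotient.sound (RightAdequateRel.mul_star_self x)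
  star_star_mul_star := by
    rintro ⟨x⟩ ⟨y⟩; exact Quotient.sound (RightAdequateRel.star_star_mul_star x y)
  star_comm := by rintro ⟨x⟩ ⟨y⟩; exact Quotient.sound (RightAdequateRel.star_comm x y)
  star_mul := by rintro ⟨x⟩ ⟨y⟩; exact Quotient.sound (RightAdequateRel.star_mul x y)
  eq_star_of_idem := by
    rintro ⟨x⟩ h
    exact Quotient.sound (RightAdequateRel.eq_star_of_idem x (Quotient.exact h))
  star_mul_cancel := by
    rintro ⟨x⟩ ⟨y⟩ ⟨z⟩ h
    exact Quotient.sound (RightAdequateRel.star_mul_cancel x y z (Quotient.exact h))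

/-- The evaluation of a term in a left adequate monoid. -/
def UTerm.evalLeft {X : Type u} {M : Type v} [LeftAdequateMonoid M] (f : X → M) : UTerm X → M
  | .of x => f x
  | .one => 1
  | .mul s t => evalLeft f s * evalLeft f t
  | .un s => LeftAdequateMonoid.plus (evalLeft f s)

/-- The evaluation of a term in a right adequate monoid. -/
def UTerm.evalRight {X : Type u} {M : Type v} [RightAdequateMonoid M] (f : X → M) :
    UTerm X → M
  | .of x => f x
  | .one => 1
  | .mul s t => evalRight f s * evalRight f t
  | .un s => RightAdequateMonoid.star (evalRight f s)

theorem LeftAdequateRel.evalLeft_eq {X : Type u} {M : Type v} [LeftAdequateMonoid M]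
    (f : X → M) {s t : UTerm X} (h : LeftAdequateRel X s t) :
    s.evalLeft f = t.evalLeft f := by
  induction h with
  | refl s => rfl
  | symm _ ih => exact ih.symm
  | trans _ _ ih₁ ih₂ => exact ih₁.trans ih₂
  | mul_congr _ _ ih₁ ih₂ => simp only [UTerm.evalLeft, ih₁, ih₂]
  | un_congr _ ih => simp only [UTerm.evalLeft, ih]
  | mul_assoc x y z => exact _root_.mul_assoc _ _ _
  | one_mul x => exact _root_.one_mul _
  | mul_one x => exact _root_.mul_one _
  | plus_mul_self x => exact LeftAdequateMonoid.plus_mul_self _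
  | plus_plus_mul_plus x y => exact LeftAdequateMonoid.plus_plus_mul_plus _ _
  | plus_comm x y => exact LeftAdequateMonoid.plus_comm _ _
  | plus_mul x y => exact LeftAdequateMonoid.plus_mul _ _
  | eq_plus_of_idem x _ ih => exact LeftAdequateMonoid.eq_plus_of_idem _ ih
  | mul_plus_cancel x y z _ ih => exact LeftAdequateMonoid.mul_plus_cancel _ _ _ ih

theorem RightAdequateRel.evalRight_eq {X : Type u} {M : Type v} [RightAdequateMonoid M]
    (f : X → M) {s t : UTerm X} (h : RightAdequateRel X s t) :
    s.evalRight f = t.evalRight f := by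
  induction h with
  | refl s => rfl
  | symm _ ih => exact ih.symm
  | trans _ _ ih₁ ih₂ => exact ih₁.trans ih₂
  | mul_congr _ _ ih₁ ih₂ => simp only [UTerm.evalRight, ih₁, ih₂]
  | un_congr _ ih => simp only [UTerm.evalRight, ih]
  | mul_assoc x y z => exact _root_.mul_assoc _ _ _
  | one_mul x => exact _root_.one_mul _
  | mul_one x => exact _root_.mul_one _
  | mul_star_self x => exact RightAdequateMonoid.mul_star_self _
  | star_star_mul_star x y => exact RightAdequateMonoid.star_star_mul_star _ _
  | star_comm x y => exact RightAdequateMonoid.star_comm _ _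
  | star_mul x y => exact RightAdequateMonoid.star_mul _ _
  | eq_star_of_idem x _ ih => exact RightAdequateMonoid.eq_star_of_idem _ ih
  | star_mul_cancel x y z _ ih => exact RightAdequateMonoid.star_mul_cancel _ _ _ ih

/-- `FLAd(X)` is free on `X` in the class of left adequate monoids. -/
theorem FLAd.existsUnique_lift {X : Type u} {M : Type v} [LeftAdequateMonoid M] (f : X → M) :
    ∃! φ : FLAd X →* M, (∀ x, φ (FLAd.of x) = f x) ∧
      ∀ s, φ (LeftAdequateMonoid.plus s) = LeftAdequateMonoid.plus (φ s) := by
  refine ⟨⟨⟨Quotient.lift (UTerm.evalLeft f) fun _ _ h => LeftAdequateRel.evalLeft_eq f h, rfl⟩,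
    ?_⟩, ⟨fun _ => rfl, ?_⟩, ?_⟩
  · rintro ⟨s⟩ ⟨t⟩; rfl
  · rintro ⟨s⟩; rfl
  · rintro ψ ⟨h₁, h₂⟩
    ext ⟨s⟩
    induction s with
    | of x => exact h₁ x
    | one => exact map_one ψ
    | mul s t ihs iht => exact (map_mul ψ _ _).trans (congrArg₂ (· * ·) ihs iht)
    | un s ih => exact (h₂ _).trans (congrArg LeftAdequateMonoid.plus ih)

/-- `FRAd(X)` is free on `X` in the class of right adequate monoids. -/
theorem FRAd.existsUnique_lift {X : Type u} {M : Type v} [RightAdequateMonoid M] (f : X → M) :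
    ∃! φ : FRAd X →* M, (∀ x, φ (FRAd.of x) = f x) ∧
      ∀ s, φ (RightAdequateMonoid.star s) = RightAdequateMonoid.star (φ s) := by
  refine ⟨⟨⟨Quotient.lift (UTerm.evalRight f) fun _ _ h => RightAdequateRel.evalRight_eq f h,
    rfl⟩, ?_⟩, ⟨fun _ => rfl, ?_⟩, ?_⟩
  · rintro ⟨s⟩ ⟨t⟩; rfl
  · rintro ⟨s⟩; rfl
  · rintro ψ ⟨h₁, h₂⟩
    ext ⟨s⟩
    induction s with
    | of x => exact h₁ x
    | one => exact map_one ψ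
    | mul s t ihs iht => exact (map_mul ψ _ _).trans (congrArg₂ (· * ·) ihs iht)
    | un s ih => exact (h₂ _).trans (congrArg RightAdequateMonoid.star ih)

/-! ### Words -/

/-- `|u|_y`: the number of occurrences of the letter `y` in the word `u`. -/
def wordCount {α : Type u} [DecidableEq α] (y : α) (u : FreeMonoid α) : ℕ :=
  u.toList.count y

/-- The shortest suffix of a list containing `x`; the whole list if `x` does not occur. -/
def listSuff {α : Type u} [DecidableEq α] (x : α) : List α → List α
  | [] => []
  | a :: l => if x ∈ l then listSuff x l else a :: l

/-- The shortest prefix of a list containing `x`; the whole list if `x` does not occur. -/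
def listPref {α : Type u} [DecidableEq α] (x : α) : List α → List α
  | [] => []
  | a :: l => if a = x then [a] else a :: listPref x l

/-- `suff_u(x)`: the shortest suffix of `u` containing `x`, and `u` if `x` does not occur. -/
def suff {α : Type u} [DecidableEq α] (u : FreeMonoid α) (x : α) : FreeMonoid α :=
  FreeMonoid.ofList (listSuff x u.toList)

/-- `pref_u(x)`: the shortest prefix of `u` containing `x`, and `u` if `x` does not occur. -/
def pref {α : Type u} [DecidableEq α] (u : FreeMonoid α) (x : α) : FreeMonoid α :=
  FreeMonoid.ofList (listPref x u.toList)

/-! ### Monoid identities and varieties -/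

/-- The monoid `M` satisfies the monoid identity `s ≈ t`. -/
def SatisfiesIdentity (M : Type v) [Monoid M] {α : Type u} (s t : FreeMonoid α) : Prop :=
  ∀ φ : FreeMonoid α →* M, φ s = φ t

/-- The identity `s ≈ t` is a consequence of the identity `p ≈ q`: every monoid (in `Type w`)
satisfying `p ≈ q` satisfies `s ≈ t`. -/
def IsConsequence {α : Type u} {β : Type v} (s t : FreeMonoid α) (p q : FreeMonoid β) : Prop :=
  ∀ (M : Type w) [Monoid M], SatisfiesIdentity M p q → SatisfiesIdentity M s t

/-- The word `xyzxty` over the four letters `x, y, z, t = 0, 1, 2, 3`. -/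
def word_xyzxty : FreeMonoid (Fin 4) := FreeMonoid.ofList [0, 1, 2, 0, 3, 1]

/-- The word `yxzxty` over the four letters `x, y, z, t = 0, 1, 2, 3`. -/
def word_yxzxty : FreeMonoid (Fin 4) := FreeMonoid.ofList [1, 0, 2, 0, 3, 1]

/-- The word `xzytxy` over the four letters `x, y, z, t = 0, 1, 2, 3`. -/
def word_xzytxy : FreeMonoid (Fin 4) := FreeMonoid.ofList [0, 2, 1, 3, 0, 1]

/-- The word `xzytyx` over the four letters `x, y, z, t = 0, 1, 2, 3`. -/
def word_xzytyx : FreeMonoid (Fin 4) := FreeMonoid.ofList [0, 2, 1, 3, 1, 0]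

/-- A class of monoids is a variety: it is closed under homomorphic images, submonoids and
arbitrary direct products. -/
structure IsMonoidVariety (C : (M : Type w) → [Monoid M] → Prop) : Prop where
  image : ∀ (M N : Type w) [Monoid M] [Monoid N] (f : M →* N),
    Function.Surjective f → C M → C N
  submonoid : ∀ (M : Type w) [Monoid M] (S : Submonoid M), C M → C S
  pi : ∀ (ι : Type w) (M : ι → Type w) [∀ i, Monoid (M i)], (∀ i, C (M i)) → C (∀ i, M i)

/-- `N` belongs to the monoid variety generated by `M`, that is, to every variety of monoids that
contains (a copy, in the universe of `N`, of) `M`. -/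
def InGeneratedVariety (M : Type) [Monoid M] (N : Type w) [Monoid N] : Prop :=
  ∀ C : (K : Type w) → [Monoid K] → Prop, IsMonoidVariety C → C (ULift.{w} M) → C N

/-! ### The sylvester and #-sylvester monoids -/

/-- The sylvester relations `c a v b = a c v b` for letters `a ≤ b < c` and words `v`. -/
inductive SylvesterRel (A : Type u) [LinearOrder A] : FreeMonoid A → FreeMonoid A → Prop
  | mk (a b c : A) (v : FreeMonoid A) (hab : a ≤ b) (hbc : b < c) :
      SylvesterRel A (.of c * .of a * v * .of b) (.of a * .of c * v * .of b)

/-- The #-sylvester relations `b v a c = b v c a` for letters `a < b ≤ c` and words `v`. -/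
inductive SharpSylvesterRel (A : Type u) [LinearOrder A] : FreeMonoid A → FreeMonoid A → Prop
  | mk (a b c : A) (v : FreeMonoid A) (hab : a < b) (hbc : b ≤ c) :
      SharpSylvesterRel A (.of b * v * .of a * .of c) (.of b * v * .of c * .of a)

/-- The sylvester monoid (over the alphabet of positive integers): the free monoid modulo the
sylvester congruence. -/
abbrev SylvesterMonoid : Type := PresentedMonoid (SylvesterRel ℕ+)

/-- The #-sylvester monoid (over the alphabet of positive integers): the free monoid modulo the
#-sylvester congruence. -/
abbrev SharpSylvesterMonoid : Type := PresentedMonoid (SharpSylvesterRel ℕ+)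

/-! Two properties of a monoid pin down its identities. If it satisfies `xyzxty ≈ yxzxty`, then
adjacent factors that both recur later commute; this is enough to rewrite any word into any other
word with the same letter counts and the same suffix counts (`SuffEquiv.prod_eq`). If it maps onto
enough tropical affine maps `d ↦ shift + max height d` (`SeparatesSuffixes`), then those counts can
be read off from its identities, because a truncation loses one unit of height for each translation
to its right. Together they give `satisfiesIdentity_iff_suffEquiv`.

`FLAd Unit` has both properties: it is generated as a monoid by `a` and the chain of idempotents `(a
^ d)⁺`, and such an idempotent is absorbed by any product in which it occurs; the tropical pairs
form a left adequate monoid, so freeness supplies the morphisms. The sylvester monoid has both by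
inspection of its relations. The right-handed statements follow by passing to opposite monoids and
mirrored words. Equality of varieties is then Birkhoff's theorem, since the identities agree. -/

section Identities

/-! ### Transfer of identities, mirror images, and the swap identity. -/

variable {α : Type u} {M : Type v} {N : Type w} [Monoid M] [Monoid N]

theorem SatisfiesIdentity.of_injective {s t : FreeMonoid α} (f : N →* M)
    (hf : Function.Injective f) (h : SatisfiesIdentity M s t) : SatisfiesIdentity N s t :=
  fun φ => hf (h (f.comp φ))

theorem SatisfiesIdentity.of_surjective {s t : FreeMonoid α} (f : M →* N)
    (hf : Function.Surjective f) (h : SatisfiesIdentity M s t) : SatisfiesIdentity N s t := by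
  intro φ
  have hφ : φ = f.comp (FreeMonoid.lift fun x => Function.surjInv hf (φ (.of x))) := by
    ext x
    simp [Function.surjInv_eq hf]
  rw [hφ]
  exact congrArg f (h _)

theorem satisfiesIdentity_ulift_iff {s t : FreeMonoid α} :
    SatisfiesIdentity (ULift.{w} M) s t ↔ SatisfiesIdentity M s t :=
  ⟨.of_surjective (MulEquiv.ulift : ULift.{w} M ≃* M).toMonoidHom MulEquiv.ulift.surjective,
    .of_injective (MulEquiv.ulift : ULift.{w} M ≃* M).toMonoidHom MulEquiv.ulift.injective⟩

theorem satisfiesIdentity_iff_prod {s t : FreeMonoid α} :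
    SatisfiesIdentity M s t ↔ ∀ f : α → M, (s.toList.map f).prod = (t.toList.map f).prod := by
  constructor
  · intro h f
    simpa [FreeMonoid.lift_apply] using h (FreeMonoid.lift f)
  · intro h φ
    have := h (fun x => φ (.of x))
    rw [← FreeMonoid.lift_apply, ← FreeMonoid.lift_apply] at this
    rwa [show FreeMonoid.lift (fun x => φ (.of x)) = φ from FreeMonoid.lift_restrict φ] at this

/-- The mirror image of a word. -/
def mirror (s : FreeMonoid α) : FreeMonoid α := FreeMonoid.ofList s.toList.reverse

theorem satisfiesIdentity_op_mirror_iff {s t : FreeMonoid α} :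
    SatisfiesIdentity Mᵐᵒᵖ (mirror s) (mirror t) ↔ SatisfiesIdentity M s t := by
  have key : ∀ (l : List α) (f : α → M),
      (l.reverse.map fun x => MulOpposite.op (f x)).prod = MulOpposite.op (l.map f).prod := by
    intro l f
    rw [MulOpposite.op_list_prod, List.map_reverse, List.map_map]
    rfl
  simp only [satisfiesIdentity_iff_prod, mirror, FreeMonoid.toList_ofList]
  constructor
  · intro h f
    have := h fun x => MulOpposite.op (f x)
    rw [key, key] at this
    exact MulOpposite.op_injective this
  · intro h f
    have := key s.toList fun x => (f x).unop
    have := key t.toList fun x => (f x).unop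
    simp_all [MulOpposite.op_unop]

theorem satisfiesIdentity_xyzxty_iff :
    SatisfiesIdentity M word_xyzxty word_yxzxty ↔
      ∀ x y z t : M, x * (y * (z * (x * (t * y)))) = y * (x * (z * (x * (t * y)))) := by
  simp only [satisfiesIdentity_iff_prod, word_xyzxty, word_yxzxty, FreeMonoid.toList_ofList]
  constructor
  · intro h x y z t
    simpa using h ![x, y, z, t]
  · intro h f
    simpa using h (f 0) (f 1) (f 2) (f 3)

/-- Reversing the two words and exchanging `x ↔ y`, `z ↔ t` turns one identity into the other, hence
the permuted tuples below. -/
theorem satisfiesIdentity_xzytxy_iff :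
    SatisfiesIdentity M word_xzytxy word_xzytyx ↔
      SatisfiesIdentity Mᵐᵒᵖ word_xyzxty word_yxzxty := by
  rw [satisfiesIdentity_xyzxty_iff]
  simp only [satisfiesIdentity_iff_prod, word_xzytxy, word_xzytyx, FreeMonoid.toList_ofList]
  constructor
  · intro h x y z t
    apply MulOpposite.unop_injective
    simpa [mul_assoc] using h ![y.unop, x.unop, t.unop, z.unop]
  · intro h f
    have := congrArg MulOpposite.unop
      (h (.op (f 1)) (.op (f 0)) (.op (f 3)) (.op (f 2)))
    simpa [mul_assoc] using this

/-- In a monoid satisfying `xyzxty ≈ yxzxty`, adjacent letters that both occur later in a word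
may be swapped. -/
theorem swap_of_satisfiesIdentity (h : SatisfiesIdentity M word_xyzxty word_yxzxty)
    (f : α → M) {a b : α} {l : List α} (ha : a ∈ l) (hb : b ∈ l) :
    f a * (f b * (l.map f).prod) = f b * (f a * (l.map f).prod) := by
  rw [satisfiesIdentity_xyzxty_iff] at h
  by_cases hab : a = b
  · rw [hab]
  obtain ⟨l₁, l₂, rfl⟩ := List.append_of_mem ha
  have hb' : b ∈ l₁ ∨ b ∈ l₂ := by
    simp only [List.mem_append, List.mem_cons] at hb
    tauto
  have key : ∀ x y z t r : M, x * (y * (z * (x * (t * (y * r))))) =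
      y * (x * (z * (x * (t * (y * r))))) := by
    intro x y z t r
    simpa only [mul_assoc] using congrArg (· * r) (h x y z t)
  rcases hb' with hb' | hb'
  -- Here `b` recurs before the chosen `a`, so `b` plays the role of `x` and the equation is read
  -- backwards.
  · obtain ⟨l₃, l₄, rfl⟩ := List.append_of_mem hb'
    simpa [mul_assoc] using
      (key (f b) (f a) (l₃.map f).prod (l₄.map f).prod (l₂.map f).prod).symm
  · obtain ⟨l₃, l₄, rfl⟩ := List.append_of_mem hb'
    simpa [mul_assoc] using
      key (f a) (f b) (l₁.map f).prod (l₃.map f).prod (l₄.map f).prod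

/-- A monoid generated by a family in which adjacent letters that both occur later may be swapped
satisfies `xyzxty ≈ yxzxty`. -/
theorem satisfiesIdentity_of_swap (f : α → M)
    (hsurj : ∀ x : M, ∃ l : List α, (l.map f).prod = x)
    (swap : ∀ (a b : α) (l : List α), a ∈ l → b ∈ l →
      f a * (f b * (l.map f).prod) = f b * (f a * (l.map f).prod)) :
    SatisfiesIdentity M word_xyzxty word_yxzxty := by
  have one : ∀ (a : α) (l₂ l : List α), a ∈ l → (∀ b ∈ l₂, b ∈ l) →
      f a * ((l₂.map f).prod * (l.map f).prod) = (l₂.map f).prod * (f a * (l.map f).prod) := by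
    intro a l₂ l ha hl
    induction l₂ with
    | nil => simp
    | cons b l₂ ih =>
      have h₁ := swap a b (l₂ ++ l) (by simp [ha]) (by simp [hl])
      have h₂ := ih fun c hc => hl c (by simp [hc])
      simp only [List.map_append, List.prod_append] at h₁
      simp only [List.map_cons, List.prod_cons, mul_assoc]
      rw [h₁, h₂]
  have many : ∀ l₁ l₂ l : List α, (∀ a ∈ l₁, a ∈ l) → (∀ b ∈ l₂, b ∈ l) →
      (l₁.map f).prod * ((l₂.map f).prod * (l.map f).prod) =
        (l₂.map f).prod * ((l₁.map f).prod * (l.map f).prod) := by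
    intro l₁ l₂ l h₁ h₂
    induction l₁ with
    | nil => simp
    | cons a l₁ ih =>
      have h := one a l₂ (l₁ ++ l) (by simp [h₁]) (fun b hb => by simp [h₂ b hb])
      simp only [List.map_append, List.prod_append] at h
      simp only [List.map_cons, List.prod_cons, mul_assoc]
      rw [ih fun c hc => h₁ c (by simp [hc]), h]
  rw [satisfiesIdentity_xyzxty_iff]
  intro x y z t
  obtain ⟨x, rfl⟩ := hsurj x
  obtain ⟨y, rfl⟩ := hsurj y
  obtain ⟨z, rfl⟩ := hsurj z
  obtain ⟨t, rfl⟩ := hsurj t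
  -- Every letter of `x` and of `y` recurs in `z x t y`, so the two whole words commute in front of
  -- it.
  have := many x y (z ++ (x ++ (t ++ y))) (fun a ha => by simp [ha]) (fun a ha => by simp [ha])
  simpa using this

end Identities

/-! ### Shortest suffixes and the combinatorics of `SuffEquiv`. -/

section Words

variable {α : Type u} [DecidableEq α]

theorem listSuff_cons_of_mem {x : α} {l : List α} (h : x ∈ l) (a : α) :
    listSuff x (a :: l) = listSuff x l := by
  simp [listSuff, h]

theorem listSuff_cons_of_notMem {x : α} {l : List α} (h : x ∉ l) (a : α) :
    listSuff x (a :: l) = a :: l := by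
  simp [listSuff, h]

theorem listSuff_of_notMem {x : α} {l : List α} (h : x ∉ l) : listSuff x l = l := by
  cases l with
  | nil => rfl
  | cons a l => exact listSuff_cons_of_notMem (fun h' => h (List.mem_cons_of_mem _ h')) a

theorem listSuff_append_of_mem {x : α} {l : List α} (h : x ∈ l) (p : List α) :
    listSuff x (p ++ l) = listSuff x l := by
  induction p with
  | nil => rfl
  | cons a p ih => rw [List.cons_append, listSuff_cons_of_mem (by simp [h]), ih]

theorem listSuff_suffix (x : α) (l : List α) : listSuff x l <:+ l := by
  induction l with
  | nil => exact List.suffix_rfl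
  | cons a l ih =>
    unfold listSuff
    split_ifs
    · exact ih.trans (List.suffix_cons a l)
    · exact List.suffix_rfl

theorem suffix_listSuff_append {x : α} {l : List α} (h : x ∉ l) (p : List α) :
    l <:+ listSuff x (p ++ l) := by
  induction p with
  | nil => rw [List.nil_append, listSuff_of_notMem h]
  | cons a p ih =>
    rw [List.cons_append, listSuff]
    split_ifs
    · exact ih
    · exact List.suffix_append (a :: p) l

theorem count_listSuff_self {x : α} {l : List α} (h : x ∈ l) :
    (listSuff x l).count x = 1 := by
  induction l with
  | nil => simp at h
  | cons a l ih =>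
    by_cases hx : x ∈ l
    · rw [listSuff_cons_of_mem hx, ih hx]
    · obtain rfl : x = a := by simpa [hx] using h
      rw [listSuff_cons_of_notMem hx, List.count_cons_self, List.count_eq_zero_of_not_mem hx]

theorem listPref_append_of_mem {x : α} {l : List α} (h : x ∈ l) (r : List α) :
    listPref x (l ++ r) = listPref x l := by
  induction l with
  | nil => simp at h
  | cons a l ih =>
    rw [List.cons_append, listPref, listPref]
    split_ifs with hax
    · rfl
    · rw [ih (by simpa [Ne.symm hax] using h)]

theorem listPref_append_of_notMem {x : α} {l : List α} (h : x ∉ l) (r : List α) :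
    listPref x (l ++ r) = l ++ listPref x r := by
  induction l with
  | nil => rfl
  | cons a l ih =>
    simp only [List.mem_cons, not_or] at h
    rw [List.cons_append, listPref, if_neg (Ne.symm h.1), ih h.2, List.cons_append]

theorem listSuff_reverse (x : α) (l : List α) :
    listSuff x l.reverse = (listPref x l).reverse := by
  rw [← List.reverse_reverse l]
  generalize l.reverse = l
  rw [List.reverse_reverse]
  induction l with
  | nil => rfl
  | cons a l ih =>
    rw [List.reverse_cons]
    by_cases hx : x ∈ l
    · rw [listSuff_cons_of_mem hx, listPref_append_of_mem (by simpa using hx), ih]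
    · rw [listSuff_cons_of_notMem hx, listPref_append_of_notMem (by simpa using hx)]
      simp [listPref]

/-- Two words have the same content and the same contents of shortest suffixes. -/
def SuffEquiv (s t : List α) : Prop :=
  ∀ x y : α, s.count y = t.count y ∧ (listSuff x s).count y = (listSuff x t).count y

/-- If `a :: s` and `t` have the same suffix contents, then some occurrence of `a` in `t` is
preceded only by letters that are repeated after it. -/
theorem SuffEquiv.exists_split {a : α} {s t : List α} (h : SuffEquiv (a :: s) t) :
    ∃ p q, t = p ++ a :: q ∧ (∀ b ∈ p, b ∈ q) ∧ (p ≠ [] → a ∈ q) := by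
  have hcount := fun y => (h y y).1
  have hat : a ∈ t := by
    rw [← List.count_pos_iff, ← hcount, List.count_cons_self]
    omega
  -- The occurrence chosen is the first one: `a ∉ p`.
  obtain ⟨p, q, rfl, hp⟩ := List.eq_append_cons_of_mem hat
  refine ⟨p, q, rfl, ?_⟩
  have hca := hcount a
  have hp0 := List.count_eq_zero_of_not_mem hp
  rw [List.count_cons_self, List.count_append, List.count_cons_self] at hca
  by_cases has : a ∈ s
  · have haq : a ∈ q := by
      rw [← List.count_pos_iff] at has ⊢
      omega
    refine ⟨fun b hb => ?_, fun _ => haq⟩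
    by_contra hbq
    have hba : b ≠ a := fun e => hp (e ▸ hb)
    have hbs : b ∈ s := by
      have hb' : b ∈ a :: s := by
        rw [← List.count_pos_iff, hcount, List.count_pos_iff]
        simp [hb]
      simpa [hba] using hb'
    -- If `b` did not recur in `q`, its shortest suffix in `t` would contain `a :: q`, hence every
    -- `a` of `t`; in `a :: s` it lies within `s` and misses the leading `a`.
    have h₁ := (suffix_listSuff_append (x := b) (l := a :: q)
      (by simp [hba, hbq]) p).sublist.count_le a
    have h₂ := (listSuff_suffix b s).sublist.count_le a
    rw [← (h b a).2, listSuff_cons_of_mem hbs, List.count_cons_self] at h₁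
    omega
  · have haq : a ∉ q := by
      rw [← List.count_pos_iff] at has ⊢
      omega
    -- Now `a` occurs once on each side. Its shortest suffix is all of `a :: s` but only `a :: q` in
    -- `t`, so equal counts leave no room for `p`.
    have hp' : p = [] := by
      refine List.eq_nil_iff_forall_not_mem.2 fun b hb => ?_
      have h₁ := (h a b).2
      rw [listSuff_cons_of_notMem has, hcount, listSuff_append_of_mem (by simp),
        listSuff_cons_of_notMem haq, List.count_append] at h₁
      have := List.count_pos_iff.2 hb
      omega
    simp [hp']

/-- Deleting the two copies of `a` is harmless: for `x ∈ q` both shortest suffixes avoid the deleted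
letter, and for `x ∉ q` the letter `x` is absent from both remaining words, whose suffixes are then
the whole words. -/
theorem SuffEquiv.of_split {a : α} {s p q : List α} (h : SuffEquiv (a :: s) (p ++ a :: q))
    (hpq : ∀ b ∈ p, b ∈ q) : SuffEquiv s (p ++ q) := by
  have hcount : ∀ y, s.count y = (p ++ q).count y := by
    intro y
    have := (h y y).1
    simp only [List.count_append, List.count_cons] at this ⊢
    omega
  refine fun x y => ⟨hcount y, ?_⟩
  by_cases hx : x ∈ q
  · have hxs : x ∈ s := by
      rw [← List.count_pos_iff, hcount, List.count_pos_iff]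
      simp [hx]
    have := (h x y).2
    rwa [listSuff_cons_of_mem hxs, listSuff_append_of_mem (by simp [hx]),
      listSuff_cons_of_mem hx, ← listSuff_append_of_mem hx p] at this
  · have hx' : x ∉ p ++ q := by
      simpa [hx] using fun h => hx (hpq x h)
    have hxs : x ∉ s := by
      rwa [← List.count_pos_iff, hcount, List.count_pos_iff]
    rw [listSuff_of_notMem hx', listSuff_of_notMem hxs, hcount]

/-- The first letter of `s` is matched with its first occurrence in `t`, cancelled by induction, and
moved to the front of `t` by swaps. -/
theorem SuffEquiv.prod_eq {M : Type v} [Monoid M] (f : α → M)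
    (hM : SatisfiesIdentity M word_xyzxty word_yxzxty) {s t : List α} (h : SuffEquiv s t) :
    (s.map f).prod = (t.map f).prod := by
  induction s generalizing t with
  | nil =>
    obtain rfl : t = [] := by
      refine List.eq_nil_iff_forall_not_mem.2 fun b hb => ?_
      have := (h b b).1
      have := List.count_pos_iff.2 hb
      simp_all
    rfl
  | cons a s ih =>
    obtain ⟨p, q, rfl, hpq, hq⟩ := h.exists_split
    rw [List.map_cons, List.prod_cons, ih (h.of_split hpq)]
    -- It remains to carry `a` leftwards through `p`; each swap is allowed since `a` and the letters
    -- of `p` recur in `q`.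
    clear ih h
    induction p with
    | nil => simp
    | cons b p ih =>
      have haq : a ∈ q := hq (by simp)
      have := ih (fun c hc => hpq c (by simp [hc])) (fun _ => haq)
      rw [List.cons_append, List.cons_append, List.map_cons, List.prod_cons, List.map_cons,
        List.prod_cons, ← this]
      exact swap_of_satisfiesIdentity hM f (by simp [haq]) (by simp [hpq b])

end Words

/-! ### The tropical monoid that detects suffix counts. -/

/-- Pairs of natural numbers; the pair `(shift, height)` stands for the tropical affine map
`d ↦ shift + max height d`. -/
@[ext]
structure TropicalPair : Type where
  /-- the translation part -/
  shift : ℕ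
  /-- the truncation level -/
  height : ℕ

namespace TropicalPair

/-- Composition of the affine maps, `y` applied first. Truncated subtraction is correct because the
maximum with `y.height ≥ 0` is taken. -/
instance : Mul TropicalPair :=
  ⟨fun x y => ⟨x.shift + y.shift, max (x.height - y.shift) y.height⟩⟩

instance : One TropicalPair := ⟨⟨0, 0⟩⟩

@[simp] theorem mul_shift (x y : TropicalPair) : (x * y).shift = x.shift + y.shift := rfl

@[simp] theorem mul_height (x y : TropicalPair) :
    (x * y).height = max (x.height - y.shift) y.height := rfl

@[simp] theorem one_shift : (1 : TropicalPair).shift = 0 := rfl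

@[simp] theorem one_height : (1 : TropicalPair).height = 0 := rfl

/-- `plus x` is the truncation `d ↦ max (shift + height) d`, the idempotent with the same image as
`x`. Thus `x z = y z` says that `x` and `y` agree on the image of `z⁺`. -/
instance : LeftAdequateMonoid TropicalPair where
  plus x := ⟨0, x.shift + x.height⟩
  mul_assoc x y z := by ext <;> simp <;> omega
  one_mul x := by ext <;> simp
  mul_one x := by ext <;> simp
  plus_mul_self x := by ext <;> simp
  plus_plus_mul_plus x y := by ext <;> simp
  plus_comm x y := by ext <;> simp; omega
  plus_mul x y := by ext <;> simp; omega
  eq_plus_of_idem x h := by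
    have : x.shift + x.shift = x.shift := congrArg shift h
    have : x.shift = 0 := by omega
    ext <;> simp [this]
  mul_plus_cancel x y z h := by
    have h₁ := congrArg shift h
    have h₂ := congrArg height h
    ext <;> simp at h₁ h₂ ⊢ <;> omega

@[simp] theorem plus_eq (x : TropicalPair) :
    LeftAdequateMonoid.plus x = ⟨0, x.shift + x.height⟩ := rfl

theorem pow_eq (n : ℕ) : (⟨1, 0⟩ : TropicalPair) ^ n = ⟨n, 0⟩ := by
  induction n with
  | zero => rfl
  | succ n ih => rw [pow_succ, ih]; ext <;> simp

section

variable {α : Type u} [DecidableEq α]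

/-- The assignment sending `y` to the translation, `x` to a truncation and the rest to `1`. -/
def letters (x y : α) (d : ℕ) (c : α) : TropicalPair :=
  if c = y then ⟨1, 0⟩ else if c = x then ⟨0, d⟩ else 1

theorem prod_letters_shift (x y : α) (d : ℕ) (l : List α) :
    (l.map (letters x y d)).prod.shift = l.count y := by
  induction l with
  | nil => rfl
  | cons c l ih =>
    rw [List.map_cons, List.prod_cons, mul_shift, ih, List.count_cons, letters]
    split_ifs <;> simp_all [add_comm]

/-- Each `y` to the right of an `x` lowers its truncation level by one, so the last `x` dominates
the maximum. -/
theorem prod_letters_height {x y : α} (hxy : x ≠ y) (d : ℕ) (l : List α) :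
    (l.map (letters x y d)).prod.height =
      if x ∈ l then d - (listSuff x l).count y else 0 := by
  induction l with
  | nil => rfl
  | cons c l ih =>
    rw [List.map_cons, List.prod_cons, mul_height, ih, prod_letters_shift]
    have hle := (listSuff_suffix x l).sublist.count_le y
    by_cases hx : x ∈ l
    · rw [listSuff_cons_of_mem hx, if_pos hx, if_pos (List.mem_cons_of_mem c hx), letters]
      split_ifs <;> simp
      omega
    · rw [listSuff_cons_of_notMem hx, if_neg hx, letters]
      by_cases hc : c = x
      · subst hc
        simp [hxy]
      · have hx' : x ∉ c :: l := by simp [hx, Ne.symm hc]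
        rw [if_neg hx']
        split_ifs <;> simp

end

end TropicalPair

/-- For every `d`, the monoid maps to `TropicalPair` with the translation and the truncation at
level `d` in the image. -/
def SeparatesSuffixes (M : Type v) [Monoid M] : Prop :=
  ∀ d : ℕ, ∃ g : M →* TropicalPair, (∃ m, g m = ⟨1, 0⟩) ∧ ∃ m, g m = ⟨0, d⟩

theorem SeparatesSuffixes.suffEquiv {α : Type u} [DecidableEq α] {M : Type v} [Monoid M]
    (hM : SeparatesSuffixes M) {s t : FreeMonoid α} (h : SatisfiesIdentity M s t) :
    SuffEquiv s.toList t.toList := by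
  rw [satisfiesIdentity_iff_prod] at h
  have key : ∀ (x y : α) (d : ℕ), (s.toList.map (TropicalPair.letters x y d)).prod =
      (t.toList.map (TropicalPair.letters x y d)).prod := by
    intro x y d
    obtain ⟨g, ⟨m₁, h₁⟩, m₀, h₀⟩ := hM d
    have hg : TropicalPair.letters x y d =
        g ∘ fun c => if c = y then m₁ else if c = x then m₀ else 1 := by
      ext1 c
      simp only [TropicalPair.letters, Function.comp_apply]
      split_ifs <;> simp [*]
    rw [hg, ← List.map_map, ← List.map_map, ← map_list_prod, ← map_list_prod, h]
  have hcount : ∀ y, s.toList.count y = t.toList.count y := by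
    intro y
    simpa only [TropicalPair.prod_letters_shift] using
      congrArg TropicalPair.shift (key y y 0)
  refine fun x y => ⟨hcount y, ?_⟩
  have hmem : x ∈ s.toList ↔ x ∈ t.toList := by
    rw [← List.count_pos_iff, hcount, List.count_pos_iff]
  by_cases hx : x ∈ s.toList
  · have hx' := hmem.1 hx
    by_cases hxy : x = y
    · subst hxy
      rw [count_listSuff_self hx, count_listSuff_self hx']
    -- The level exceeds every count of `y` involved, so the truncated subtraction is injective on
    -- them.
    · have := congrArg TropicalPair.height (key x y (s.toList.count y + 1))
      rw [TropicalPair.prod_letters_height hxy, TropicalPair.prod_letters_height hxy,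
        if_pos hx, if_pos hx'] at this
      have h₁ := (listSuff_suffix x s.toList).sublist.count_le y
      have h₂ := (listSuff_suffix x t.toList).sublist.count_le y
      have h₃ := hcount y
      omega
  · rw [listSuff_of_notMem hx, listSuff_of_notMem (mt hmem.2 hx), hcount]

theorem satisfiesIdentity_iff_suffEquiv {α : Type u} [DecidableEq α] {M : Type v} [Monoid M]
    (hM : SatisfiesIdentity M word_xyzxty word_yxzxty) (hM' : SeparatesSuffixes M)
    {s t : FreeMonoid α} :
    SatisfiesIdentity M s t ↔ SuffEquiv s.toList t.toList :=
  ⟨hM'.suffEquiv, fun h => satisfiesIdentity_iff_prod.2 fun f => h.prod_eq f hM⟩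

/-! ### Monogenic left adequate monoids. -/

section Adequate

open LeftAdequateMonoid

variable {M : Type v} [LeftAdequateMonoid M]

theorem plus_idem (x : M) : plus x * plus x = plus x := by
  rw [← plus_plus_mul_plus, ← plus_mul, plus_mul_self]

theorem plus_mul_plus_mul (x y : M) : plus x * plus (x * y) = plus (x * y) := by
  rw [← plus_plus_mul_plus, ← plus_mul, ← mul_assoc, plus_mul_self]

theorem plus_pow_mul_plus_pow (a : M) (c d : ℕ) :
    plus (a ^ c) * plus (a ^ d) = plus (a ^ max c d) := by
  rcases le_total c d with h | h
  · rw [max_eq_right h, ← Nat.add_sub_of_le h, pow_add, plus_mul_plus_mul]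
  · rw [plus_comm, max_eq_left h, ← Nat.add_sub_of_le h, pow_add, plus_mul_plus_mul]

/-- The generators of the monogenic left adequate monoid generated by `a`, as a monoid. -/
def adequateGenerator (a : M) : Option ℕ → M
  | none => a
  | some d => plus (a ^ d)

/-- This makes the submonoid generated by `a` and the `(a ^ d)⁺` closed under `plus`. -/
theorem plus_prod_adequateGenerator (a : M) (l : List (Option ℕ)) :
    ∃ k, plus (l.map (adequateGenerator a)).prod = plus (a ^ k) := by
  induction l with
  | nil => exact ⟨0, by simp⟩
  | cons g l ih =>
    obtain ⟨k, hk⟩ := ih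
    rw [List.map_cons, List.prod_cons, plus_mul, hk]
    cases g with
    | none => exact ⟨k + 1, by rw [pow_succ', plus_mul a (a ^ k)]; rfl⟩
    | some d =>
      exact ⟨max d k, by rw [adequateGenerator, plus_plus_mul_plus, plus_pow_mul_plus_pow]⟩

/-- The element `a (a ^ d)⁺` is fixed on the left by `(a ^ (d + 1))⁺`, which lies below `(a ^ d)⁺`
in the chain of idempotents. -/
theorem plus_pow_mul_self_mul (a : M) (d : ℕ) (x : M) (h : plus (a ^ d) * x = x) :
    plus (a ^ d) * (a * x) = a * x := by
  have h₁ : plus (a ^ (d + 1)) * (a * plus (a ^ d)) = a * plus (a ^ d) := by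
    rw [pow_succ', plus_mul, plus_mul_self]
  have h₂ : plus (a ^ d) * (a * plus (a ^ d)) = a * plus (a ^ d) := by
    rw [← h₁, ← mul_assoc, plus_pow_mul_plus_pow, max_eq_right (Nat.le_succ d)]
  calc plus (a ^ d) * (a * x) = plus (a ^ d) * (a * (plus (a ^ d) * x)) := by rw [h]
    _ = plus (a ^ d) * (a * plus (a ^ d)) * x := by simp only [mul_assoc]
    _ = a * (plus (a ^ d) * x) := by rw [h₂, mul_assoc]
    _ = a * x := by rw [h]

theorem plus_pow_mul_prod (a : M) {d : ℕ} {l : List (Option ℕ)} (h : some d ∈ l) :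
    plus (a ^ d) * (l.map (adequateGenerator a)).prod = (l.map (adequateGenerator a)).prod := by
  induction l with
  | nil => simp at h
  | cons g l ih =>
    rw [List.map_cons, List.prod_cons]
    by_cases hg : some d = g
    · subst hg
      rw [adequateGenerator, ← mul_assoc, plus_idem]
    · have hl := ih (by simpa [hg] using h)
      cases g with
      | none => exact plus_pow_mul_self_mul a d _ hl
      | some c =>
        rw [adequateGenerator, ← mul_assoc, plus_comm, mul_assoc, hl]

theorem adequateGenerator_swap (a : M) (g h : Option ℕ) (l : List (Option ℕ))
    (hg : g ∈ l) (hh : h ∈ l) :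
    adequateGenerator a g * (adequateGenerator a h * (l.map (adequateGenerator a)).prod) =
      adequateGenerator a h * (adequateGenerator a g * (l.map (adequateGenerator a)).prod) := by
  cases g with
  | none =>
    cases h with
    | none => rfl
    | some d =>
      simp only [adequateGenerator]
      rw [plus_pow_mul_prod a hh, plus_pow_mul_self_mul a d _ (plus_pow_mul_prod a hh)]
  | some c =>
    cases h with
    | none =>
      simp only [adequateGenerator]
      rw [plus_pow_mul_prod a hg, plus_pow_mul_self_mul a c _ (plus_pow_mul_prod a hg)]
    | some d =>
      simp only [adequateGenerator]
      rw [← mul_assoc, plus_comm, mul_assoc]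

/-- A left adequate monoid generated by one element satisfies `xyzxty ≈ yxzxty`. -/
theorem satisfiesIdentity_of_monogenic (a : M)
    (hgen : ∀ P : M → Prop, P a → P 1 → (∀ x y, P x → P y → P (x * y)) →
      (∀ x, P x → P (plus x)) → ∀ x, P x) :
    SatisfiesIdentity M word_xyzxty word_yxzxty := by
  refine satisfiesIdentity_of_swap (adequateGenerator a) ?_ (adequateGenerator_swap a)
  refine hgen _ ⟨[none], by simp [adequateGenerator]⟩ ⟨[], by simp⟩ ?_ ?_
  · rintro _ _ ⟨l, rfl⟩ ⟨l', rfl⟩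
    exact ⟨l ++ l', by simp⟩
  · rintro _ ⟨l, rfl⟩
    obtain ⟨k, hk⟩ := plus_prod_adequateGenerator a l
    exact ⟨[some k], by simp [adequateGenerator, hk]⟩

end Adequate

/-! ### Left-right duality, and the two properties for the free monogenic monoids. -/

section Opposite

instance {M : Type v} [RightAdequateMonoid M] : LeftAdequateMonoid Mᵐᵒᵖ where
  plus x := .op (RightAdequateMonoid.star x.unop)
  plus_mul_self x := congrArg MulOpposite.op (RightAdequateMonoid.mul_star_self x.unop)
  plus_plus_mul_plus x y :=
    congrArg MulOpposite.op (RightAdequateMonoid.star_star_mul_star y.unop x.unop)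
  plus_comm x y := congrArg MulOpposite.op (RightAdequateMonoid.star_comm y.unop x.unop)
  plus_mul x y := congrArg MulOpposite.op (RightAdequateMonoid.star_mul y.unop x.unop)
  eq_plus_of_idem x h := congrArg MulOpposite.op
    (RightAdequateMonoid.eq_star_of_idem x.unop (congrArg MulOpposite.unop h))
  mul_plus_cancel x y z h := congrArg MulOpposite.op
    (RightAdequateMonoid.star_mul_cancel x.unop y.unop z.unop (congrArg MulOpposite.unop h))

/-- This makes `TropicalPairᵐᵒᵖ` a target for the universal property of `FRAd`. -/
instance {M : Type v} [LeftAdequateMonoid M] : RightAdequateMonoid Mᵐᵒᵖ where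
  star x := .op (LeftAdequateMonoid.plus x.unop)
  mul_star_self x := congrArg MulOpposite.op (LeftAdequateMonoid.plus_mul_self x.unop)
  star_star_mul_star x y :=
    congrArg MulOpposite.op (LeftAdequateMonoid.plus_plus_mul_plus y.unop x.unop)
  star_comm x y := congrArg MulOpposite.op (LeftAdequateMonoid.plus_comm y.unop x.unop)
  star_mul x y := congrArg MulOpposite.op (LeftAdequateMonoid.plus_mul y.unop x.unop)
  eq_star_of_idem x h := congrArg MulOpposite.op
    (LeftAdequateMonoid.eq_plus_of_idem x.unop (congrArg MulOpposite.unop h))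
  star_mul_cancel x y z h := congrArg MulOpposite.op
    (LeftAdequateMonoid.mul_plus_cancel x.unop y.unop z.unop (congrArg MulOpposite.unop h))

end Opposite

theorem FLAd.satisfiesIdentity_xyzxty :
    SatisfiesIdentity (FLAd Unit) word_xyzxty word_yxzxty := by
  refine satisfiesIdentity_of_monogenic (FLAd.of ()) fun P ha h1 hmul hplus => ?_
  rintro ⟨s⟩
  induction s with
  | of x => exact ha
  | one => exact h1
  | mul s t ihs iht => exact hmul _ _ ihs iht
  | un s ih => exact hplus _ ih

theorem FLAd.separatesSuffixes : SeparatesSuffixes (FLAd Unit) := by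
  intro d
  obtain ⟨g, ⟨hof, hplus⟩, -⟩ :=
    FLAd.existsUnique_lift (M := TropicalPair) fun _ : Unit => ⟨1, 0⟩
  refine ⟨g, ⟨_, hof ()⟩, LeftAdequateMonoid.plus (FLAd.of () ^ d), ?_⟩
  rw [hplus, map_pow, hof, TropicalPair.pow_eq]
  simp

theorem FRAd.op_satisfiesIdentity_xyzxty :
    SatisfiesIdentity (FRAd Unit)ᵐᵒᵖ word_xyzxty word_yxzxty := by
  refine satisfiesIdentity_of_monogenic (.op (FRAd.of ())) fun P ha h1 hmul hplus => ?_
  intro x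
  obtain ⟨x, rfl⟩ := MulOpposite.op_surjective x
  obtain ⟨s⟩ := x
  induction s with
  | of x => exact ha
  | one => exact h1
  | mul s t ihs iht => exact hmul _ _ iht ihs
  | un s ih => exact hplus _ ih

theorem SeparatesSuffixes.op {M : Type v} [Monoid M]
    (h : ∀ d : ℕ, ∃ g : M →* TropicalPairᵐᵒᵖ, (∃ m, g m = .op ⟨1, 0⟩) ∧ ∃ m, g m = .op ⟨0, d⟩) :
    SeparatesSuffixes Mᵐᵒᵖ := by
  intro d
  obtain ⟨g, ⟨m₁, h₁⟩, m₀, h₀⟩ := h d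
  exact ⟨{ toFun := fun x => (g x.unop).unop, map_one' := by simp, map_mul' := by simp },
    ⟨.op m₁, congrArg MulOpposite.unop h₁⟩, .op m₀, congrArg MulOpposite.unop h₀⟩

theorem FRAd.op_separatesSuffixes : SeparatesSuffixes (FRAd Unit)ᵐᵒᵖ := by
  refine SeparatesSuffixes.op fun d => ?_
  obtain ⟨g, ⟨hof, hstar⟩, -⟩ :=
    FRAd.existsUnique_lift (M := TropicalPairᵐᵒᵖ) fun _ : Unit => .op ⟨1, 0⟩
  refine ⟨g, ⟨_, hof ()⟩, RightAdequateMonoid.star (FRAd.of () ^ d), ?_⟩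
  rw [hstar, map_pow, hof, ← MulOpposite.op_pow, TropicalPair.pow_eq]
  change MulOpposite.op (LeftAdequateMonoid.plus _) = _
  simp

/-! ### The two properties for the sylvester and #-sylvester monoids. -/

section Sylvester

theorem PresentedMonoid.mk_eq_prod_of {α : Type u} (rel : FreeMonoid α → FreeMonoid α → Prop)
    (l : FreeMonoid α) :
    PresentedMonoid.mk rel l = (l.toList.map (PresentedMonoid.of rel)).prod := by
  rw [← FreeMonoid.lift_apply]
  congr 1
  ext x
  simp [PresentedMonoid.of]

theorem PresentedMonoid.exists_prod_of {α : Type u} {rel : FreeMonoid α → FreeMonoid α → Prop}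
    (x : PresentedMonoid rel) :
    ∃ l : List α, (l.map (PresentedMonoid.of rel)).prod = x := by
  induction x with
  | _ l => exact ⟨l.toList, (PresentedMonoid.mk_eq_prod_of rel l).symm⟩

theorem satisfiesIdentity_sylvester (A : Type u) [LinearOrder A] :
    SatisfiesIdentity (PresentedMonoid (SylvesterRel A)) word_xyzxty word_yxzxty := by
  refine satisfiesIdentity_of_swap (PresentedMonoid.of _) PresentedMonoid.exists_prod_of ?_
  have key : ∀ (a c : A) (l : List A), a < c → a ∈ l →
      PresentedMonoid.of (SylvesterRel A) c * (PresentedMonoid.of _ a * (l.map (.of _)).prod) =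
        PresentedMonoid.of _ a * (PresentedMonoid.of _ c * (l.map (.of _)).prod) := by
    intro a c l hac ha
    obtain ⟨l₁, l₂, rfl⟩ := List.append_of_mem ha
    -- The case `b = a` of the relation: a recurrence of the smaller letter alone permits the swap.
    have h := PresentedMonoid.mk_eq_mk_of_rel
      (SylvesterRel.mk a a c (FreeMonoid.ofList l₁) le_rfl hac)
    simp only [PresentedMonoid.mk_eq_prod_of, FreeMonoid.toList_mul, FreeMonoid.toList_of,
      FreeMonoid.toList_ofList] at h
    have := congrArg (· * (l₂.map (.of _)).prod) h
    simpa [mul_assoc] using this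
  intro a b l ha hb
  rcases lt_trichotomy a b with hab | rfl | hab
  · exact (key a b l hab ha).symm
  · rfl
  · exact key b a l hab hb

theorem satisfiesIdentity_op_sharpSylvester (A : Type u) [LinearOrder A] :
    SatisfiesIdentity (PresentedMonoid (SharpSylvesterRel A))ᵐᵒᵖ word_xyzxty word_yxzxty := by
  have hprod : ∀ l : List A,
      (l.map fun a => MulOpposite.op (PresentedMonoid.of (SharpSylvesterRel A) a)).prod =
        .op (l.reverse.map (.of _)).prod := by
    intro l
    rw [MulOpposite.op_list_prod, List.map_reverse, List.map_reverse, List.reverse_reverse,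
      List.map_map]
    rfl
  refine satisfiesIdentity_of_swap
    (fun a => MulOpposite.op (PresentedMonoid.of (SharpSylvesterRel A) a)) ?_ ?_
  · intro x
    obtain ⟨l, hl⟩ := PresentedMonoid.exists_prod_of x.unop
    exact ⟨l.reverse, by rw [hprod, List.reverse_reverse, hl, MulOpposite.op_unop]⟩
  have key : ∀ (a c : A) (l : List A), a < c → c ∈ l →
      (l.map (PresentedMonoid.of (SharpSylvesterRel A))).prod * .of _ a * .of _ c =
        (l.map (PresentedMonoid.of (SharpSylvesterRel A))).prod * .of _ c * .of _ a := by
    intro a c l hac hc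
    obtain ⟨l₁, l₂, rfl⟩ := List.append_of_mem hc
    -- The case `b = c`: an earlier occurrence of the larger letter suffices.
    have h := PresentedMonoid.mk_eq_mk_of_rel
      (SharpSylvesterRel.mk a c c (FreeMonoid.ofList l₂) hac le_rfl)
    simp only [PresentedMonoid.mk_eq_prod_of, FreeMonoid.toList_mul, FreeMonoid.toList_of,
      FreeMonoid.toList_ofList] at h
    have := congrArg ((l₁.map (.of _)).prod * ·) h
    simpa [mul_assoc] using this
  intro a b l ha hb
  simp only [hprod, ← MulOpposite.op_mul]
  congr 1
  rcases lt_trichotomy a b with hab | rfl | hab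
  · exact (key a b l.reverse hab (by simpa using hb)).symm
  · rfl
  · exact key b a l.reverse hab (by simpa using ha)

theorem separatesSuffixes_sylvester {A : Type u} [LinearOrder A] [Nontrivial A] :
    SeparatesSuffixes (PresentedMonoid (SylvesterRel A)) := by
  intro d
  obtain ⟨x, y, hxy⟩ := exists_pair_lt A
  -- The images of `a` and `c` fail to commute at most when `c = y`; then `a` and `b` lie below `y`,
  -- and the truncation at `b` absorbs the difference.
  let f : A → TropicalPair := fun l => if l < y then ⟨0, d⟩ else if l = y then ⟨1, 0⟩ else 1
  have hf : ∀ s t, SylvesterRel A s t → FreeMonoid.lift f s = FreeMonoid.lift f t := by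
    rintro _ _ ⟨a, b, c, v, hab, hbc⟩
    simp only [map_mul, FreeMonoid.lift_eval_of]
    generalize FreeMonoid.lift f v = w
    simp only [f]
    split_ifs <;> first | (exfalso; order) | (ext <;> simp <;> omega)
  exact ⟨PresentedMonoid.lift f hf,
    ⟨.of _ y, (PresentedMonoid.lift_of f hf).trans (by simp [f])⟩,
    .of _ x, (PresentedMonoid.lift_of f hf).trans (by simp [f, hxy])⟩

theorem separatesSuffixes_op_sharpSylvester {A : Type u} [LinearOrder A] [Nontrivial A] :
    SeparatesSuffixes (PresentedMonoid (SharpSylvesterRel A))ᵐᵒᵖ := by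
  refine SeparatesSuffixes.op fun d => ?_
  obtain ⟨y, x, hxy⟩ := exists_pair_lt A
  -- Dually, the critical case is `a = y`, where `b` and `c` lie above `y` and become truncations.
  let f : A → TropicalPairᵐᵒᵖ := fun l =>
    .op (if y < l then ⟨0, d⟩ else if l = y then ⟨1, 0⟩ else 1)
  have hf : ∀ s t, SharpSylvesterRel A s t → FreeMonoid.lift f s = FreeMonoid.lift f t := by
    rintro _ _ ⟨a, b, c, v, hab, hbc⟩
    simp only [map_mul, FreeMonoid.lift_eval_of]
    generalize FreeMonoid.lift f v = w
    simp only [f]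
    apply MulOpposite.unop_injective
    simp only [MulOpposite.unop_mul, MulOpposite.unop_op]
    split_ifs <;> first | (exfalso; order) | (ext <;> simp)
  exact ⟨PresentedMonoid.lift f hf,
    ⟨.of _ y, (PresentedMonoid.lift_of f hf).trans (by simp [f])⟩,
    .of _ x, (PresentedMonoid.lift_of f hf).trans (by simp [f, hxy])⟩

end Sylvester

/-! ### Generated varieties are determined by identities. -/

section Varieties

theorem isMonoidVariety_satisfiesIdentity {α : Type u} (s t : FreeMonoid α) :
    IsMonoidVariety.{w} fun K _ => SatisfiesIdentity K s t where
  image _ _ _ _ f hf h := h.of_surjective f hf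
  submonoid _ _ S h := h.of_injective S.subtype S.subtype_injective
  pi ι M _ h φ := by
    ext i
    exact h i ((Pi.evalMonoidHom M i).comp φ)

/-- Birkhoff's theorem for the variety generated by a single monoid. -/
theorem inGeneratedVariety_iff {M : Type} [Monoid M] {N : Type w} [Monoid N] :
    InGeneratedVariety M N ↔
      ∀ s t : FreeMonoid N, SatisfiesIdentity M s t → SatisfiesIdentity N s t := by
  constructor
  · intro h s t hst
    exact h _ (isMonoidVariety_satisfiesIdentity s t) (satisfiesIdentity_ulift_iff.2 hst)
  · intro h C hC hM
    -- Evaluation at all morphisms into the lifted `M`: two words have equal image exactly when they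
    -- form an identity of `M`. Hence `ev` factors through the range of `e`, a submonoid of a power
    -- of `M`, and `N` is a quotient of it.
    let e : FreeMonoid N →* ((FreeMonoid N →* ULift.{w} M) → ULift.{w} M) :=
      { toFun := fun s φ => φ s, map_one' := by ext; simp, map_mul' := by intros; ext; simp }
    let ev : FreeMonoid N →* N := FreeMonoid.lift id
    have hle : Con.ker e.mrangeRestrict ≤ Con.ker ev := by
      intro s t hst
      refine h s t (satisfiesIdentity_ulift_iff.1 fun φ => ?_) ev
      exact congrFun (congrArg Subtype.val hst) φ
    have hsurj : Function.Surjective e.mrangeRestrict := e.mrangeRestrict_surjective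
    let q : MonoidHom.mrange e →* N := (Con.lift _ ev hle).comp
      (Con.quotientKerEquivOfSurjective e.mrangeRestrict hsurj).symm.toMonoidHom
    refine hC.image _ _ q ?_ (hC.submonoid _ _ (hC.pi _ _ fun _ => hM))
    intro x
    refine ⟨e.mrangeRestrict (.of x), ?_⟩
    have hx : (Con.quotientKerEquivOfSurjective e.mrangeRestrict hsurj).symm
        (e.mrangeRestrict (.of x)) = ((FreeMonoid.of x : FreeMonoid N) :
          (Con.ker e.mrangeRestrict).Quotient) := by
      rw [MulEquiv.symm_apply_eq]
      rfl
    change Con.lift _ ev hle ((Con.quotientKerEquivOfSurjective e.mrangeRestrict hsurj).symm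
      (e.mrangeRestrict (.of x))) = x
    rw [hx]
    simp [ev]

theorem inGeneratedVariety_congr {M M' : Type} [Monoid M] [Monoid M']
    (h : ∀ (α : Type w) (s t : FreeMonoid α), SatisfiesIdentity M s t ↔ SatisfiesIdentity M' s t)
    (N : Type w) [Monoid N] : InGeneratedVariety M N ↔ InGeneratedVariety M' N := by
  simp only [inGeneratedVariety_iff, h]

end Varieties

/-! ### Assembly of the equivalences, with mirrored words for the right-handed case. -/

section Main

variable {α : Type u} [DecidableEq α] {M : Type} [Monoid M]

theorem suffEquiv_iff_wordCount {s t : FreeMonoid α} :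
    SuffEquiv s.toList t.toList ↔ ∀ x y : α, wordCount y s = wordCount y t ∧
      wordCount y (suff s x) = wordCount y (suff t x) := Iff.rfl

theorem suffEquiv_mirror_iff_wordCount {s t : FreeMonoid α} :
    SuffEquiv (mirror s).toList (mirror t).toList ↔
      ∀ x y : α, wordCount y s = wordCount y t ∧
        wordCount y (pref s x) = wordCount y (pref t x) := by
  simp only [SuffEquiv, mirror, wordCount, pref, FreeMonoid.toList_ofList, listSuff_reverse,
    List.count_reverse]

theorem satisfiesIdentity_iff_isConsequence
    (hM : SatisfiesIdentity M word_xyzxty word_yxzxty) (hM' : SeparatesSuffixes M)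
    (s t : FreeMonoid α) :
    SatisfiesIdentity M s t ↔ IsConsequence.{u, 0, w} s t word_xyzxty word_yxzxty := by
  constructor
  · intro h K _ hK
    exact satisfiesIdentity_iff_prod.2 fun f => (hM'.suffEquiv h).prod_eq f hK
  · intro h
    exact satisfiesIdentity_ulift_iff.1 (h (ULift.{w} M) (satisfiesIdentity_ulift_iff.2 hM))

theorem satisfiesIdentity_iff_isConsequence_of_op
    (hM : SatisfiesIdentity Mᵐᵒᵖ word_xyzxty word_yxzxty) (hM' : SeparatesSuffixes Mᵐᵒᵖ)
    (s t : FreeMonoid α) :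
    SatisfiesIdentity M s t ↔ IsConsequence.{u, 0, w} s t word_xzytxy word_xzytyx := by
  constructor
  · intro h K _ hK
    rw [satisfiesIdentity_xzytxy_iff] at hK
    rw [← satisfiesIdentity_op_mirror_iff] at h ⊢
    exact satisfiesIdentity_iff_prod.2 fun f => (hM'.suffEquiv h).prod_eq f hK
  · intro h
    exact satisfiesIdentity_ulift_iff.1 (h (ULift.{w} M)
      (satisfiesIdentity_ulift_iff.2 (satisfiesIdentity_xzytxy_iff.2 hM)))

theorem satisfiesIdentity_iff_mirror_suffEquiv
    (hM : SatisfiesIdentity Mᵐᵒᵖ word_xyzxty word_yxzxty) (hM' : SeparatesSuffixes Mᵐᵒᵖ)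
    (s t : FreeMonoid α) :
    SatisfiesIdentity M s t ↔ SuffEquiv (mirror s).toList (mirror t).toList := by
  rw [← satisfiesIdentity_op_mirror_iff, satisfiesIdentity_iff_suffEquiv hM hM']

end Main

theorem mainTheorem4 :
    -- identities of the monogenic free left adequate monoid
    (∀ (α : Type u) [DecidableEq α] (s t : FreeMonoid α),
      (SatisfiesIdentity (FLAd Unit) s t ↔
        ∀ x y : α, wordCount y s = wordCount y t ∧
          wordCount y (suff s x) = wordCount y (suff t x)) ∧
      (SatisfiesIdentity (FLAd Unit) s t ↔
        IsConsequence.{u, 0, w} s t word_xyzxty word_yxzxty)) ∧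
    -- identities of the monogenic free right adequate monoid
    (∀ (α : Type u) [DecidableEq α] (s t : FreeMonoid α),
      (SatisfiesIdentity (FRAd Unit) s t ↔
        ∀ x y : α, wordCount y s = wordCount y t ∧
          wordCount y (pref s x) = wordCount y (pref t x)) ∧
      (SatisfiesIdentity (FRAd Unit) s t ↔
        IsConsequence.{u, 0, w} s t word_xzytxy word_xzytyx)) ∧
    -- the generated monoid varieties
    (∀ (N : Type w) [Monoid N],
      InGeneratedVariety (FLAd Unit) N ↔ InGeneratedVariety SylvesterMonoid N) ∧
    (∀ (N : Type w) [Monoid N],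
      InGeneratedVariety (FRAd Unit) N ↔ InGeneratedVariety SharpSylvesterMonoid N) := by
  refine ⟨fun α _ s t => ⟨?_, ?_⟩, fun α _ s t => ⟨?_, ?_⟩, ?_, ?_⟩
  · rw [satisfiesIdentity_iff_suffEquiv FLAd.satisfiesIdentity_xyzxty FLAd.separatesSuffixes,
      suffEquiv_iff_wordCount]
  · exact satisfiesIdentity_iff_isConsequence FLAd.satisfiesIdentity_xyzxty
      FLAd.separatesSuffixes s t
  · rw [satisfiesIdentity_iff_mirror_suffEquiv FRAd.op_satisfiesIdentity_xyzxty
      FRAd.op_separatesSuffixes, suffEquiv_mirror_iff_wordCount]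
  · exact satisfiesIdentity_iff_isConsequence_of_op FRAd.op_satisfiesIdentity_xyzxty
      FRAd.op_separatesSuffixes s t
  · refine fun N _ => inGeneratedVariety_congr (fun α s t => ?_) N
    classical
    rw [satisfiesIdentity_iff_suffEquiv FLAd.satisfiesIdentity_xyzxty FLAd.separatesSuffixes,
      satisfiesIdentity_iff_suffEquiv (satisfiesIdentity_sylvester ℕ+)
        separatesSuffixes_sylvester]
  · refine fun N _ => inGeneratedVariety_congr (fun α s t => ?_) N
    classical
    rw [satisfiesIdentity_iff_mirror_suffEquiv FRAd.op_satisfiesIdentity_xyzxty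
        FRAd.op_separatesSuffixes,
      satisfiesIdentity_iff_mirror_suffEquiv (satisfiesIdentity_op_sharpSylvester ℕ+)
        separatesSuffixes_op_sharpSylvester]
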